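/- **Proposition.** Let $d\ge 2$, $1\le r\le d$, and let $\mathbb L\in\mathbb R^{d\times d}$ be symmetric positive semidefinite with $L=\|\mathbb L\|>0$, where $\|\cdot\|$ is the operator norm induced by the Euclidean norm. Put $$r_{\mathrm{eff}}=\frac{\operatorname{tr}(\mathbb L)}{L},\qquad \delta_{\mathrm{diag}}=\frac{\|\operatorname{diag}(\mathbb L)\|}{L},\qquad \beta=\frac{d(d-r)}{(d+2)(d-1)},$$ where $\operatorname{diag}(\mathbb L)$ is the diagonal matrix with the same diagonal entries as $\mathbb L$. Say that a random matrix $P\in\mathbb R^{d\times r}$ satisfies the sketch assumption with constants $\omega,\ell$ if $\omega>0$, $\ell>0$, and (the expectations existing) $$\mathbb E[PP^\top]=I_d,\qquad \mathbb E[(PP^\top)^2]\preceq \omega I_d,\qquad \mathbb E[PP^\top\,\mathbb L\,PP^\top]\preceq \ell L\, I_d,$$ where $A\preceq B$ means that $B-A$ is positive semidefinite. Then the following random matrices satisfy the sketch assumption with the stated constants. 1. (Haar) $P=\sqrt{d/r}\,R$, where $R$ consists of the first $r$ columns of a Haar-distributed orthogonal $d\times d$ matrix: $$\omega=\frac dr,\qquad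 \ell=\frac dr\Bigl(1-\beta+\beta\,\frac{r_{\mathrm{eff}}}{d}\Bigr).$$ 2. (Coordinate) $P=\sqrt{d/r}\,S$, where $S$ consists of $r$ distinct columns of $I_d$, the set of chosen columns being uniformly distributed over all $r$-element subsets and listed in any (possibly random) order: $$\omega=\frac dr,\qquad \ell=\frac dr\Bigl(\frac{r-1}{d-1}+\frac{d-r}{d-1}\,\delta_{\mathrm{diag}}\Bigr).$$ 3. (Gaussian) $P$ has i.i.d. entries $P_{ij}\sim\mathcal N(0,1/r)$: $$\omega=\frac{d+r+1}{r},\qquad \ell=\frac{r+1+r_{\mathrm{eff}}}{r}.$$ Moreover, $$1\le r_{\mathrm{eff}}\le d,\qquad \frac1d\le\delta_{\mathrm{diag}}\le 1,\qquad \delta_{\mathrm{diag}}\ge\frac{r_{\mathrm{eff}}}{d}.$$ -/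

import Mathlib

open MeasureTheory ProbabilityTheory

noncomputable section

namespace Sketch

/-- The operator norm of a square real matrix induced by the Euclidean norm. -/
def opNorm {d : ℕ} (A : Matrix (Fin d) (Fin d) ℝ) : ℝ :=
  ‖Matrix.toEuclideanCLM (n := Fin d) (𝕜 := ℝ) A‖

/-- The diagonal matrix with the same diagonal entries as `A`. -/
def diagPart {d : ℕ} (A : Matrix (Fin d) (Fin d) ℝ) : Matrix (Fin d) (Fin d) ℝ :=
  Matrix.diagonal A.diag

/-- The effective rank `tr A / ‖A‖`. -/
def rEff {d : ℕ} (A : Matrix (Fin d) (Fin d) ℝ) : ℝ :=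
  A.trace / opNorm A

/-- The ratio `‖diag A‖ / ‖A‖`. -/
def deltaDiag {d : ℕ} (A : Matrix (Fin d) (Fin d) ℝ) : ℝ :=
  opNorm (diagPart A) / opNorm A

/-- A random matrix all of whose entries are integrable. -/
def MatIntegrable {Ω : Type*} [MeasurableSpace Ω] {m n : ℕ}
    (X : Ω → Matrix (Fin m) (Fin n) ℝ) (μ : Measure Ω) : Prop :=
  ∀ i j, Integrable (fun w => X w i j) μ

/-- The (entrywise) expectation of a random matrix. -/
def expect {Ω : Type*} [MeasurableSpace Ω] {m n : ℕ}
    (X : Ω → Matrix (Fin m) (Fin n) ℝ) (μ : Measure Ω) : Matrix (Fin m) (Fin n) ℝ :=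
  Matrix.of fun i j => ∫ w, X w i j ∂μ

/-- The Loewner order: `B - A` is (symmetric and) positive semidefinite. -/
def LoewnerLE {d : ℕ} (A B : Matrix (Fin d) (Fin d) ℝ) : Prop :=
  (B - A).PosSemidef

/-- The sketch moment conditions for the random matrix `P`, the smoothness matrix `Lmat`
(with `L = ‖Lmat‖`) and the constants `ω` and `ℓ`. The three expectations are required to
exist. -/
structure SketchMoments {Ω : Type*} [MeasurableSpace Ω] {d r : ℕ}
    (P : Ω → Matrix (Fin d) (Fin r) ℝ) (μ : Measure Ω)
    (Lmat : Matrix (Fin d) (Fin d) ℝ) (ω ℓ : ℝ) : Prop where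
  aemeasurable : ∀ i j, AEMeasurable (fun w => P w i j) μ
  omega_pos : 0 < ω
  ell_pos : 0 < ℓ
  integrable_first : MatIntegrable (fun w => P w * (P w).transpose) μ
  integrable_second : MatIntegrable (fun w => (P w * (P w).transpose) ^ 2) μ
  integrable_smooth :
    MatIntegrable (fun w => P w * (P w).transpose * Lmat * (P w * (P w).transpose)) μ
  unbiased : expect (fun w => P w * (P w).transpose) μ = 1
  second_moment :
    LoewnerLE (expect (fun w => (P w * (P w).transpose) ^ 2) μ) (ω • 1)
  smooth_sketch :
    LoewnerLE
      (expect (fun w => P w * (P w).transpose * Lmat * (P w * (P w).transpose)) μ)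
      ((ℓ * opNorm Lmat) • 1)

/-- The orthogonal group carries its Borel σ-algebra. -/
instance instMeasurableSpaceOrthogonal (d : ℕ) :
    MeasurableSpace (Matrix.orthogonalGroup (Fin d) ℝ) :=
  borel _

instance instBorelSpaceOrthogonal (d : ℕ) :
    BorelSpace (Matrix.orthogonalGroup (Fin d) ℝ) :=
  ⟨rfl⟩

/-- A random orthogonal matrix is Haar distributed: its law is a Haar measure (necessarily the
unique Haar probability measure when `μ` is a probability measure). -/
def IsHaarDistributed {Ω : Type*} [MeasurableSpace Ω] {d : ℕ}
    (U : Ω → Matrix.orthogonalGroup (Fin d) ℝ) (μ : Measure Ω) : Prop :=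
  AEMeasurable U μ ∧ (μ.map U).IsHaarMeasure

/-- `√(d/r)` times the first `r` columns of the orthogonal matrix `U`. -/
def haarSketch {d r : ℕ} (hrd : r ≤ d) (U : Matrix.orthogonalGroup (Fin d) ℝ) :
    Matrix (Fin d) (Fin r) ℝ :=
  Real.sqrt ((d : ℝ) / r) •
    (U : Matrix (Fin d) (Fin d) ℝ).submatrix id (Fin.castLE hrd)

/-- `J` lists `r` distinct random indices such that the set of selected indices is uniformly
distributed over all `r`-element subsets of `Fin d`. The order in which the indices are listed
may be random or not. -/
def IsUniformSample {Ω : Type*} [MeasurableSpace Ω] {d r : ℕ}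
    (J : Ω → (Fin r ↪ Fin d)) (μ : Measure Ω) : Prop :=
  (∀ k, AEMeasurable (fun w => J w k) μ) ∧
    ∀ s : Finset (Fin d), s.card = r →
      μ {w | Finset.univ.map (J w) = s} = ((d.choose r : ℕ) : ENNReal)⁻¹

/-- `√(d/r)` times the columns of the identity matrix selected by `J`. -/
def coordinateSketch {d r : ℕ} (J : Fin r ↪ Fin d) : Matrix (Fin d) (Fin r) ℝ :=
  Real.sqrt ((d : ℝ) / r) • (1 : Matrix (Fin d) (Fin d) ℝ).submatrix id J

/-- The entries of `P` are independent with law `N(0, 1/r)`. -/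
def IsGaussianSketch {Ω : Type*} [MeasurableSpace Ω] {d r : ℕ}
    (P : Ω → Matrix (Fin d) (Fin r) ℝ) (μ : Measure Ω) : Prop :=
  (∀ i j, HasLaw (fun w => P w i j) (gaussianReal 0 (1 / (r : NNReal))) μ) ∧
    iIndepFun (fun (p : Fin d × Fin r) w => P w p.1 p.2) μ

/-- `β = d (d - r) / ((d + 2) (d - 1))`. -/
def beta (d r : ℕ) : ℝ :=
  (d : ℝ) * ((d : ℝ) - r) / (((d : ℝ) + 2) * ((d : ℝ) - 1))

def omegaHaar (d r : ℕ) : ℝ := (d : ℝ) / r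

def ellHaar {d : ℕ} (r : ℕ) (Lmat : Matrix (Fin d) (Fin d) ℝ) : ℝ :=
  (d : ℝ) / r * (1 - beta d r + beta d r * (rEff Lmat / d))

def omegaCoordinate (d r : ℕ) : ℝ := (d : ℝ) / r

def ellCoordinate {d : ℕ} (r : ℕ) (Lmat : Matrix (Fin d) (Fin d) ℝ) : ℝ :=
  (d : ℝ) / r *
    (((r : ℝ) - 1) / ((d : ℝ) - 1) + ((d : ℝ) - r) / ((d : ℝ) - 1) * deltaDiag Lmat)

def omegaGaussian (d r : ℕ) : ℝ := ((d : ℝ) + r + 1) / r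

def ellGaussian {d : ℕ} (r : ℕ) (Lmat : Matrix (Fin d) (Fin d) ℝ) : ℝ :=
  ((r : ℝ) + 1 + rEff Lmat) / r

end Sketch

end

/-! With `W = P Pᵀ`, every moment in question is linear in the tensor `E[W i j * W k l]`. For all
three sketches this tensor has the form `A δ_ij δ_kl + B (δ_ik δ_jl + δ_il δ_jk) + C δ_ijkl`
(`momentTensor`). Contracting it with a symmetric `M` gives `E[W M W] = (A + B) M + B tr(M) I + C
diag M` (`expect_mul_mul`). For `M = I` this is exactly `ω I`. For `M = Lmat`, the bounds `Lmat ⪯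
‖Lmat‖ I` and `diag Lmat ⪯ ‖diag Lmat‖ I`, applied with weights `A + B ≥ 0` and `C ≥ 0`, give `ℓ L
I` (`sketchMoments_of_momentTensor`).

It remains to find `A`, `B`, `C`. In the Haar and coordinate cases, invariance under signed
permutations forces the form of the tensor (`eq_momentTensor_of_invariant`). Up to scaling, `W` is a
projection `Π` of rank `r`. For Haar, one further orthogonal invariance gives `C = 0`, and `tr Π =
r` together with `Π² = Π` determines `A` and `B`. For coordinate sampling `Π` is a diagonal 0-1
matrix, so `B = 0`, and `tr Π = r` with idempotence of the entries gives the rest. For the Gaussian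
sketch, Wick's formula gives `A = 1`, `B = 1/r`, `C = 0`.

The bounds on `rEff` and `deltaDiag` come from `‖diag Lmat‖ ≤ ‖Lmat‖ ≤ tr Lmat ≤ d ‖diag Lmat‖`. -/

namespace Sketch

open Matrix

/-! ### Operator norm, trace and diagonal of a positive semidefinite matrix. -/

section

open scoped Matrix.Norms.L2Operator in
lemma opNorm_diagonal {d : ℕ} (v : Fin d → ℝ) : opNorm (Matrix.diagonal v) = ‖v‖ := by
  rw [opNorm, Matrix.l2_opNorm_toEuclideanCLM, Matrix.l2_opNorm_diagonal]

lemma opNorm_nonneg {d : ℕ} (A : Matrix (Fin d) (Fin d) ℝ) : 0 ≤ opNorm A := norm_nonneg _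

lemma dotProduct_mulVec_le_opNorm {d : ℕ} (A : Matrix (Fin d) (Fin d) ℝ) (x : Fin d → ℝ) :
    x ⬝ᵥ (A *ᵥ x) ≤ opNorm A * (x ⬝ᵥ x) := by
  have h1 := real_inner_le_norm (WithLp.toLp 2 x)
    (Matrix.toEuclideanCLM (n := Fin d) (𝕜 := ℝ) A (WithLp.toLp 2 x))
  have h2 := (Matrix.toEuclideanCLM (n := Fin d) (𝕜 := ℝ) A).le_opNorm (WithLp.toLp 2 x)
  have h3 : inner ℝ (WithLp.toLp 2 x)
      (Matrix.toEuclideanCLM (n := Fin d) (𝕜 := ℝ) A (WithLp.toLp 2 x)) = x ⬝ᵥ (A *ᵥ x) := by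
    rw [Matrix.toEuclideanCLM_toLp, EuclideanSpace.inner_toLp_toLp, dotProduct_comm]
    simp
  have h4 : ‖(WithLp.toLp 2 x : EuclideanSpace ℝ (Fin d))‖ ^ 2 = x ⬝ᵥ x := by
    rw [← real_inner_self_eq_norm_sq, EuclideanSpace.inner_toLp_toLp]
    simp
  rw [h3] at h1
  rw [← h4, opNorm]
  nlinarith [norm_nonneg (WithLp.toLp 2 x : EuclideanSpace ℝ (Fin d))]

lemma diag_le_opNorm {d : ℕ} (A : Matrix (Fin d) (Fin d) ℝ) (i : Fin d) : A i i ≤ opNorm A := by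
  simpa [mulVec_single_one] using dotProduct_mulVec_le_opNorm A (Pi.single i 1)

lemma posSemidef_opNorm_sub {d : ℕ} {A : Matrix (Fin d) (Fin d) ℝ} (hA : A.IsHermitian) :
    (opNorm A • (1 : Matrix (Fin d) (Fin d) ℝ) - A).PosSemidef := by
  refine Matrix.PosSemidef.of_dotProduct_mulVec_nonneg
    ((Matrix.isHermitian_one.smul (IsSelfAdjoint.all _)).sub hA) fun x => ?_
  have := dotProduct_mulVec_le_opNorm A x
  simp only [sub_mulVec, smul_mulVec, one_mulVec, dotProduct_sub, dotProduct_smul, star_trivial,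
    smul_eq_mul]
  linarith

lemma isHermitian_diagPart {d : ℕ} (A : Matrix (Fin d) (Fin d) ℝ) : (diagPart A).IsHermitian := by
  simp [diagPart, Matrix.IsHermitian]

/-- The 2 × 2 minor on `i, j` is nonnegative. A submatrix along a non-injective index map is still
positive semidefinite, so `i = j` needs no separate case. -/
lemma posSemidef_sq_le {d : ℕ} {A : Matrix (Fin d) (Fin d) ℝ} (hA : A.PosSemidef)
    (i j : Fin d) : A i j ^ 2 ≤ A i i * A j j := by
  have h := (hA.submatrix ![i, j]).det_nonneg
  have hs : A j i = A i j := by simpa using hA.isHermitian.apply i j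
  rw [Matrix.det_fin_two] at h
  simp [hs] at h
  nlinarith

/-- Cauchy–Schwarz on row `i` and `A i j ^ 2 ≤ A i i * A j j` give `(A x)_i² ≤ A i i * tr A * ‖x‖²`;
summing over `i` yields `(tr A)² ‖x‖²`. No spectral decomposition is involved. -/
lemma opNorm_le_trace {d : ℕ} {A : Matrix (Fin d) (Fin d) ℝ} (hA : A.PosSemidef) :
    opNorm A ≤ A.trace := by
  have ht : 0 ≤ A.trace := hA.trace_nonneg
  refine ContinuousLinearMap.opNorm_le_bound _ ht fun x => ?_
  refine le_of_sq_le_sq ?_ (by positivity)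
  rw [mul_pow, EuclideanSpace.real_norm_sq_eq, EuclideanSpace.real_norm_sq_eq]
  have h1 : ∀ i, (Matrix.toEuclideanCLM (n := Fin d) (𝕜 := ℝ) A x) i ^ 2
      ≤ (A i i * A.trace) * ∑ j, x j ^ 2 := by
    intro i
    rw [Matrix.ofLp_toEuclideanCLM, mulVec, dotProduct]
    refine (Finset.sum_mul_sq_le_sq_mul_sq _ _ _).trans ?_
    gcongr
    rw [Matrix.trace, Finset.mul_sum]
    exact Finset.sum_le_sum fun j _ => posSemidef_sq_le hA i j
  refine (Finset.sum_le_sum fun i _ => h1 i).trans_eq ?_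
  rw [← Finset.sum_mul, ← Finset.sum_mul, sq A.trace]
  rfl

lemma trace_le_mul_opNorm_diagPart {d : ℕ} (A : Matrix (Fin d) (Fin d) ℝ) :
    A.trace ≤ d * opNorm (diagPart A) := by
  have h : ∀ i ∈ Finset.univ, A.diag i ≤ opNorm (diagPart A) := fun i _ => by
    simpa [diagPart] using diag_le_opNorm (diagPart A) i
  exact (Finset.sum_le_card_nsmul _ _ _ h).trans_eq (by simp)

lemma opNorm_diagPart_le {d : ℕ} {A : Matrix (Fin d) (Fin d) ℝ} (hA : A.PosSemidef) :
    opNorm (diagPart A) ≤ opNorm A := by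
  rw [diagPart, opNorm_diagonal, pi_norm_le_iff_of_nonneg (opNorm_nonneg A)]
  intro i
  rw [Real.norm_of_nonneg (by simpa using hA.diag_nonneg (i := i))]
  exact diag_le_opNorm A i

lemma one_le_rEff {d : ℕ} {A : Matrix (Fin d) (Fin d) ℝ} (hA : A.PosSemidef)
    (hL : 0 < opNorm A) : 1 ≤ rEff A := by
  rw [rEff, one_le_div hL]
  exact opNorm_le_trace hA

lemma deltaDiag_le_one {d : ℕ} {A : Matrix (Fin d) (Fin d) ℝ} (hA : A.PosSemidef) :
    deltaDiag A ≤ 1 :=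
  div_le_one_of_le₀ (opNorm_diagPart_le hA) (opNorm_nonneg A)

lemma rEff_div_le_deltaDiag {d : ℕ} (hd : 0 < d) (A : Matrix (Fin d) (Fin d) ℝ) :
    rEff A / d ≤ deltaDiag A := by
  have hd' : (0 : ℝ) < d := by exact_mod_cast hd
  rw [rEff, deltaDiag, div_right_comm]
  refine div_le_div_of_nonneg_right ?_ (opNorm_nonneg A)
  rw [div_le_iff₀' hd']
  exact trace_le_mul_opNorm_diagPart A

lemma rEff_le {d : ℕ} (hd : 0 < d) {A : Matrix (Fin d) (Fin d) ℝ} (hA : A.PosSemidef) :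
    rEff A ≤ d := by
  have hd' : (0 : ℝ) < d := by exact_mod_cast hd
  rw [← div_le_one hd']
  exact (rEff_div_le_deltaDiag hd A).trans (deltaDiag_le_one hA)

lemma one_div_le_deltaDiag {d : ℕ} (hd : 0 < d) {A : Matrix (Fin d) (Fin d) ℝ}
    (hA : A.PosSemidef) (hL : 0 < opNorm A) : 1 / (d : ℝ) ≤ deltaDiag A :=
  (div_le_div_of_nonneg_right (one_le_rEff hA hL) (Nat.cast_nonneg d)).trans
    (rEff_div_le_deltaDiag hd A)

end

/-! ### From the second moment tensor of `P Pᵀ` to the sketch conditions. -/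

section

/-- The value at `i, j, k, l` of a fourth order tensor that is a combination of the isotropic
tensors and of the fully diagonal one. -/
def momentTensor {d : ℕ} (A B C : ℝ) (i j k l : Fin d) : ℝ :=
  A * ((1 : Matrix (Fin d) (Fin d) ℝ) i j * (1 : Matrix (Fin d) (Fin d) ℝ) k l) +
  B * ((1 : Matrix (Fin d) (Fin d) ℝ) i k * (1 : Matrix (Fin d) (Fin d) ℝ) j l +
    (1 : Matrix (Fin d) (Fin d) ℝ) i l * (1 : Matrix (Fin d) (Fin d) ℝ) j k) +
  C * ((1 : Matrix (Fin d) (Fin d) ℝ) i j * (1 : Matrix (Fin d) (Fin d) ℝ) k l *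
    (1 : Matrix (Fin d) (Fin d) ℝ) i k)

variable {Ω : Type*} [MeasurableSpace Ω] {μ : Measure Ω} {d : ℕ}

lemma mul_mul_apply_eq_sum (W M : Matrix (Fin d) (Fin d) ℝ) (i l : Fin d) :
    (W * M * W) i l = ∑ k, ∑ j, M j k * (W i j * W k l) := by
  simp only [Matrix.mul_apply, Finset.sum_mul]
  exact Finset.sum_congr rfl fun k _ => Finset.sum_congr rfl fun j _ => by ring

lemma matIntegrable_mul_mul {W : Ω → Matrix (Fin d) (Fin d) ℝ}
    (hint : ∀ i j k l, Integrable (fun w => W w i j * W w k l) μ)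
    (M : Matrix (Fin d) (Fin d) ℝ) : MatIntegrable (fun w => W w * M * W w) μ := by
  intro i l
  simp only [mul_mul_apply_eq_sum]
  exact integrable_finsetSum _ fun k _ => integrable_finsetSum _ fun j _ =>
    (hint i j k l).const_mul _

/-- The pairing `δ_ij δ_kl` returns `M`, `δ_ik δ_jl` returns `Mᵀ = M`, `δ_il δ_jk` returns the
trace, and the fully diagonal term keeps only the diagonal of `M`. -/
lemma expect_mul_mul {W : Ω → Matrix (Fin d) (Fin d) ℝ}
    (hint : ∀ i j k l, Integrable (fun w => W w i j * W w k l) μ) {A B C : ℝ}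
    (hmom : ∀ i j k l, ∫ w, W w i j * W w k l ∂μ = momentTensor A B C i j k l)
    {M : Matrix (Fin d) (Fin d) ℝ} (hM : M.IsHermitian) :
    expect (fun w => W w * M * W w) μ =
      (A + B) • M + (B * M.trace) • (1 : Matrix (Fin d) (Fin d) ℝ) + C • diagPart M := by
  ext i l
  have hs : M l i = M i l := by simpa using hM.apply i l
  simp only [expect, Matrix.of_apply, mul_mul_apply_eq_sum]
  rw [integral_finsetSum _ fun k _ => integrable_finsetSum _ fun j _ =>
    (hint i j k l).const_mul _]
  simp_rw [integral_finsetSum Finset.univ fun j _ => (hint i j _ l).const_mul _,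
    integral_const_mul, hmom, momentTensor, mul_add, Finset.sum_add_distrib]
  have e1 : ∑ k, ∑ j, M j k * (A * ((1 : Matrix (Fin d) (Fin d) ℝ) i j *
      (1 : Matrix (Fin d) (Fin d) ℝ) k l)) = A * M i l := by
    simp [Matrix.one_apply, mul_comm]
  have e2 : ∑ k, ∑ j, M j k * (B * ((1 : Matrix (Fin d) (Fin d) ℝ) i k *
      (1 : Matrix (Fin d) (Fin d) ℝ) j l)) = B * M i l := by
    simp [Matrix.one_apply, hs, mul_comm]
  have e3 : ∑ k, ∑ j, M j k * (B * ((1 : Matrix (Fin d) (Fin d) ℝ) i l *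
      (1 : Matrix (Fin d) (Fin d) ℝ) j k)) =
      B * M.trace * (1 : Matrix (Fin d) (Fin d) ℝ) i l := by
    simp only [Matrix.trace, Finset.mul_sum, Finset.sum_mul]
    refine Finset.sum_congr rfl fun k _ => ?_
    rw [Finset.sum_eq_single k (fun j _ hj => by simp [Matrix.one_apply, hj]) (by simp)]
    simp
    ring
  have e4 : ∑ k, ∑ j, M j k * (C * ((1 : Matrix (Fin d) (Fin d) ℝ) i j *
      (1 : Matrix (Fin d) (Fin d) ℝ) k l * (1 : Matrix (Fin d) (Fin d) ℝ) i k)) =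
      C * diagPart M i l := by
    simp [Matrix.one_apply, diagPart, Matrix.diagonal_apply, mul_comm]
    split_ifs with h <;> simp [h]
  rw [e1, e2, e3, e4]
  simp only [Matrix.add_apply, Matrix.smul_apply, smul_eq_mul]
  ring

/-- Common endpoint of the three cases. The second moment bound is an equality; in the smoothness
bound the trace terms cancel and only the two norm inequalities are lossy. -/
lemma sketchMoments_of_momentTensor {r : ℕ} {P : Ω → Matrix (Fin d) (Fin r) ℝ}
    {Lmat : Matrix (Fin d) (Fin d) ℝ} (hpsd : Lmat.PosSemidef) {A B C ω ℓ : ℝ}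
    (hAB : 0 ≤ A + B) (hC : 0 ≤ C)
    (hP : ∀ i j, AEMeasurable (fun w => P w i j) μ)
    (hint₁ : ∀ i j, Integrable (fun w => (P w * (P w).transpose) i j) μ)
    (hint₂ : ∀ i j k l, Integrable
      (fun w => (P w * (P w).transpose) i j * (P w * (P w).transpose) k l) μ)
    (hmom₁ : ∀ i j, ∫ w, (P w * (P w).transpose) i j ∂μ = (1 : Matrix (Fin d) (Fin d) ℝ) i j)
    (hmom₂ : ∀ i j k l, ∫ w, (P w * (P w).transpose) i j * (P w * (P w).transpose) k l ∂μ =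
      momentTensor A B C i j k l)
    (hω : ω = A + B + B * d + C) (hω₀ : 0 < ω)
    (hℓ : ℓ * opNorm Lmat =
      (A + B) * opNorm Lmat + B * Lmat.trace + C * opNorm (diagPart Lmat)) (hℓ₀ : 0 < ℓ) :
    SketchMoments P μ Lmat ω ℓ := by
  have hsq : ∀ w, (P w * (P w).transpose) ^ 2 =
      P w * (P w).transpose * 1 * (P w * (P w).transpose) := fun w => by
    rw [Matrix.mul_one, sq]
  refine ⟨hP, hω₀, hℓ₀, hint₁, ?_, matIntegrable_mul_mul hint₂ Lmat, ?_, ?_, ?_⟩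
  · simp_rw [hsq]
    exact matIntegrable_mul_mul hint₂ 1
  · ext i j
    exact hmom₁ i j
  · simp_rw [hsq]
    rw [expect_mul_mul hint₂ hmom₂ Matrix.isHermitian_one, LoewnerLE]
    convert Matrix.PosSemidef.zero
    rw [sub_eq_zero, hω]
    have : diagPart (1 : Matrix (Fin d) (Fin d) ℝ) = 1 := by ext; simp [diagPart]
    rw [this, Matrix.trace_one, ← add_smul, ← add_smul, Fintype.card_fin]
  · rw [expect_mul_mul hint₂ hmom₂ hpsd.isHermitian, LoewnerLE, hℓ]
    -- The difference is `(A + B) (‖Lmat‖ I - Lmat) + C (‖diag Lmat‖ I - diag Lmat)`.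
    have h1 := (posSemidef_opNorm_sub hpsd.isHermitian).smul hAB
    have h2 := (posSemidef_opNorm_sub (isHermitian_diagPart Lmat)).smul hC
    convert h1.add h2 using 1
    module

end

/-! ### Tensors invariant under signed permutations. -/

section

/-- Permutations act transitively on ordered pairs of distinct indices: one swap takes `i` to `p`, a
second one fixes `p` and takes the image of `j` to `q`. -/
lemma eq_of_perm_invariant {d : ℕ} {c : Fin d → Fin d → ℝ}
    (h : ∀ (σ : Equiv.Perm (Fin d)) i j, c (σ i) (σ j) = c i j) {p q i j : Fin d}
    (hpq : p ≠ q) (hij : i ≠ j) : c i j = c p q := by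
  have h1 : c i j = c p (Equiv.swap i p j) := by
    rw [← h (Equiv.swap i p) i j, Equiv.swap_apply_left]
  have h2 : Equiv.swap i p j ≠ p := fun hj =>
    hij ((Equiv.swap i p).injective (hj.trans (Equiv.swap_apply_left i p).symm)).symm
  rw [h1, ← h (Equiv.swap (Equiv.swap i p j) q) p, Equiv.swap_apply_left,
    Equiv.swap_apply_of_ne_of_ne h2.symm hpq]

/-- A fourth order tensor with the symmetries of the second moments of a random symmetric matrix
that is invariant under permutations and sign changes of the coordinates. -/
lemma eq_momentTensor_of_invariant {d : ℕ} {T : Fin d → Fin d → Fin d → Fin d → ℝ}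
    (hsymm : ∀ i j k l, T i j l k = T i j k l)
    (hperm : ∀ (σ : Equiv.Perm (Fin d)) i j k l, T (σ i) (σ j) (σ k) (σ l) = T i j k l)
    (hsign : ∀ x i j k l, (if i = x then -1 else 1) * (if j = x then -1 else 1) *
      (if k = x then -1 else 1) * (if l = x then -1 else 1) * T i j k l = T i j k l)
    {p q : Fin d} (hpq : p ≠ q) (i j k l : Fin d) :
    T i j k l = momentTensor (T p p q q) (T p q p q)
      (T p p p p - T p p q q - 2 * T p q p q) i j k l := by
  -- Only the patterns `iiii`, `iikk`, `ikik`, `ikki` survive, with one value each by permutation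
  -- invariance; `hsymm` identifies the last two. The coefficient of the diagonal term is what makes
  -- the pattern `iiii` come out right.
  have ha : T i i i i = T p p p p := by
    rw [← hperm (Equiv.swap i p) i i i i, Equiv.swap_apply_left]
  have he : ∀ k, i ≠ k → T i i k k = T p p q q := fun k hk =>
    eq_of_perm_invariant (c := fun i k => T i i k k) (fun σ i k => hperm σ i i k k) hpq hk
  have hc : ∀ k, i ≠ k → T i k i k = T p q p q := fun k hk =>
    eq_of_perm_invariant (c := fun i k => T i k i k) (fun σ i k => hperm σ i k i k) hpq hk
  have hc' : ∀ k, i ≠ k → T i k k i = T p q p q := fun k hk => by rw [hsymm, hc k hk]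
  -- In every other pattern some index occurs an odd number of times; flipping its sign gives `T =
  -- -T`, hence zero.
  have hi := hsign i i j k l
  have hj := hsign j i j k l
  have hk := hsign k i j k l
  have hl := hsign l i j k l
  simp only [momentTensor, Matrix.one_apply]
  by_cases hij : i = j
  · subst hij
    by_cases hkl : k = l
    · subst hkl
      by_cases hik : i = k
      · subst hik; simp [ha]; ring
      · simp [hik, he k hik]
    · by_cases hik : i = k
      · subst hik
        simp [hkl] at hl ⊢
        linarith
      · simp [hik, hkl, Ne.symm hkl] at hk ⊢
        linarith
  · by_cases hik : i = k
    · subst hik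
      by_cases hjl : j = l
      · subst hjl; simp [hij, hc j hij]
      · simp [hij, hjl, Ne.symm hij, Ne.symm hjl] at hj ⊢
        linarith
    · by_cases hil : i = l
      · subst hil
        by_cases hjk : j = k
        · subst hjk; simp [hij, hc' j hij]
        · simp [hij, hjk, hik, Ne.symm hij, Ne.symm hjk] at hj ⊢
          linarith
      · simp [hij, hil, hik, Ne.symm hij, Ne.symm hil, Ne.symm hik] at hi ⊢
        linarith

variable {Ω : Type*} [MeasurableSpace Ω] {μ : Measure Ω} {d : ℕ}

lemma momentTensor_smul (s A B C : ℝ) (i j k l : Fin d) :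
    s * momentTensor A B C i j k l = momentTensor (s * A) (s * B) (s * C) i j k l := by
  simp only [momentTensor]
  ring

lemma sum_momentTensor_diag_diag (A B C : ℝ) :
    ∑ i : Fin d, ∑ j, momentTensor A B C i i j j = d ^ 2 * A + 2 * d * B + d * C := by
  simp [momentTensor, Matrix.one_apply, Finset.sum_add_distrib, ← Finset.mul_sum]
  ring

lemma sum_momentTensor_row (A B C : ℝ) (i : Fin d) :
    ∑ j, momentTensor A B C i j j i = A + (d + 1) * B + C := by
  have : ∀ j, momentTensor A B C i j j i = (if i = j then A + B + C else 0) + B := fun j => by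
    by_cases h : i = j
    · subst h; simp [momentTensor]; ring
    · simp [momentTensor, h, Ne.symm h]
  simp_rw [this]
  simp [Finset.sum_add_distrib]
  ring

end

/-! ### The projection onto the first columns of an orthogonal matrix. -/

section

variable {d r : ℕ}

/-- The orthogonal projection onto the span of the first `r` columns of `U`. -/
def colProj (hrd : r ≤ d) (U : Matrix.orthogonalGroup (Fin d) ℝ) : Matrix (Fin d) (Fin d) ℝ :=
  (U : Matrix (Fin d) (Fin d) ℝ).submatrix id (Fin.castLE hrd) *
    ((U : Matrix (Fin d) (Fin d) ℝ).submatrix id (Fin.castLE hrd))ᵀ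

lemma haarSketch_mul_transpose (hrd : r ≤ d) (U : Matrix.orthogonalGroup (Fin d) ℝ) :
    haarSketch hrd U * (haarSketch hrd U)ᵀ = ((d : ℝ) / r) • colProj hrd U := by
  rw [haarSketch, Matrix.transpose_smul, Matrix.smul_mul, Matrix.mul_smul, smul_smul,
    Real.mul_self_sqrt (by positivity), colProj]

/-- This turns left invariance of Haar measure into invariance of the law of the projection under
conjugation. -/
lemma colProj_mul (hrd : r ≤ d) (V U : Matrix.orthogonalGroup (Fin d) ℝ) :
    colProj hrd (V * U) = (V : Matrix (Fin d) (Fin d) ℝ) * colProj hrd U *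
      (V : Matrix (Fin d) (Fin d) ℝ)ᵀ := by
  have : ((V * U : Matrix.orthogonalGroup (Fin d) ℝ) : Matrix (Fin d) (Fin d) ℝ).submatrix id
      (Fin.castLE hrd) = (V : Matrix (Fin d) (Fin d) ℝ) *
      (U : Matrix (Fin d) (Fin d) ℝ).submatrix id (Fin.castLE hrd) := by
    ext i j
    simp [Matrix.mul_apply]
  rw [colProj, this, Matrix.transpose_mul, colProj]
  simp only [Matrix.mul_assoc]

lemma colProj_apply_comm (hrd : r ≤ d) (U : Matrix.orthogonalGroup (Fin d) ℝ) (i j : Fin d) :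
    colProj hrd U i j = colProj hrd U j i := by
  simp [colProj, Matrix.mul_apply, mul_comm]

lemma transpose_mul_firstCols (hrd : r ≤ d) (U : Matrix.orthogonalGroup (Fin d) ℝ) :
    ((U : Matrix (Fin d) (Fin d) ℝ).submatrix id (Fin.castLE hrd))ᵀ *
      (U : Matrix (Fin d) (Fin d) ℝ).submatrix id (Fin.castLE hrd) = 1 := by
  have h := (Matrix.mem_orthogonalGroup_iff' (Fin d) ℝ).1 U.2
  ext a b
  have := congrFun (congrFun h (Fin.castLE hrd a)) (Fin.castLE hrd b)
  simpa [Matrix.mul_apply, Matrix.one_apply] using this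

lemma colProj_mul_self (hrd : r ≤ d) (U : Matrix.orthogonalGroup (Fin d) ℝ) :
    colProj hrd U * colProj hrd U = colProj hrd U := by
  rw [colProj, Matrix.mul_assoc, ← Matrix.mul_assoc _ᵀ, transpose_mul_firstCols, Matrix.one_mul]

lemma trace_colProj (hrd : r ≤ d) (U : Matrix.orthogonalGroup (Fin d) ℝ) :
    (colProj hrd U).trace = r := by
  rw [colProj, Matrix.trace_mul_comm, transpose_mul_firstCols, Matrix.trace_one, Fintype.card_fin]

lemma continuous_orthogonal_apply (i j : Fin d) :
    Continuous fun U : Matrix.orthogonalGroup (Fin d) ℝ => (U : Matrix (Fin d) (Fin d) ℝ) i j :=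
  continuous_subtype_val.matrix_elem i j

lemma continuous_colProj (hrd : r ≤ d) (i j : Fin d) :
    Continuous fun U : Matrix.orthogonalGroup (Fin d) ℝ => colProj hrd U i j := by
  simp only [colProj, Matrix.mul_apply, Matrix.submatrix_apply, Matrix.transpose_apply]
  exact continuous_finsetSum _ fun a _ =>
    (continuous_orthogonal_apply _ _).mul (continuous_orthogonal_apply _ _)

/-- A crude bound, since orthogonal matrices have entries of modulus at most 1; it serves only for
integrability. -/
lemma abs_colProj_le (hrd : r ≤ d) (U : Matrix.orthogonalGroup (Fin d) ℝ) (i j : Fin d) :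
    |colProj hrd U i j| ≤ r := by
  simp only [colProj, Matrix.mul_apply, Matrix.submatrix_apply, Matrix.transpose_apply]
  refine (Finset.abs_sum_le_sum_abs _ _).trans ?_
  have h : ∀ a ∈ (Finset.univ : Finset (Fin r)), |(U : Matrix (Fin d) (Fin d) ℝ) (id i)
      (Fin.castLE hrd a) * (U : Matrix (Fin d) (Fin d) ℝ) (id j) (Fin.castLE hrd a)| ≤ 1 := by
    intro a _
    rw [abs_mul]
    exact mul_le_one₀ (entry_norm_bound_of_unitary U.2 _ _) (abs_nonneg _)
      (entry_norm_bound_of_unitary U.2 _ _)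
  simpa using Finset.sum_le_card_nsmul _ _ _ h

section Integrals

variable {ν : Measure (Matrix.orthogonalGroup (Fin d) ℝ)} [IsProbabilityMeasure ν]

lemma integrable_colProj (hrd : r ≤ d) (i j : Fin d) :
    Integrable (fun U => colProj hrd U i j) ν :=
  Integrable.of_bound (continuous_colProj hrd i j).measurable.aestronglyMeasurable r
    (ae_of_all _ fun U => abs_colProj_le hrd U i j)

lemma integrable_colProj_mul (hrd : r ≤ d) (i j k l : Fin d) :
    Integrable (fun U => colProj hrd U i j * colProj hrd U k l) ν :=
  (integrable_colProj hrd i j).mul_bdd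
    (continuous_colProj hrd k l).measurable.aestronglyMeasurable
    (ae_of_all _ fun U => abs_colProj_le hrd U k l)

end Integrals

/-- The reflection along a nonzero vector `u`. -/
noncomputable def reflect (u : Fin d → ℝ) (hu : u ⬝ᵥ u ≠ 0) : Matrix.orthogonalGroup (Fin d) ℝ :=
  ⟨1 - (2 / (u ⬝ᵥ u)) • Matrix.vecMulVec u u, by
    have h : Matrix.vecMulVec u u * Matrix.vecMulVec u u = (u ⬝ᵥ u) • Matrix.vecMulVec u u := by
      rw [Matrix.vecMulVec_mul_vecMulVec, Matrix.vecMulVec_smul]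
    rw [Matrix.mem_orthogonalGroup_iff]
    simp only [Matrix.transpose_sub, Matrix.transpose_smul, Matrix.transpose_vecMulVec,
      Matrix.transpose_one, Matrix.mul_sub, Matrix.sub_mul, Matrix.one_mul, Matrix.mul_one,
      Matrix.smul_mul, Matrix.mul_smul, h, smul_smul]
    rw [div_mul_cancel₀ _ hu]
    module⟩

/-- The permutation matrix of `σ`. -/
def permOrthogonal (σ : Equiv.Perm (Fin d)) : Matrix.orthogonalGroup (Fin d) ℝ :=
  ⟨(1 : Matrix (Fin d) (Fin d) ℝ).submatrix σ id, by
    rw [Matrix.mem_orthogonalGroup_iff]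
    ext i j
    simp [Matrix.mul_apply, Matrix.one_apply]⟩

lemma colProj_permOrthogonal_mul (hrd : r ≤ d) (σ : Equiv.Perm (Fin d))
    (U : Matrix.orthogonalGroup (Fin d) ℝ) (i j : Fin d) :
    colProj hrd (permOrthogonal σ * U) i j = colProj hrd U (σ i) (σ j) := by
  rw [colProj_mul]
  simp [permOrthogonal, Matrix.mul_apply, Matrix.one_apply]

/-- The diagonal matrix that changes the sign of the coordinate `x`. -/
def signOrthogonal (x : Fin d) : Matrix.orthogonalGroup (Fin d) ℝ :=
  ⟨Matrix.diagonal fun i => if i = x then -1 else 1, by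
    rw [Matrix.mem_orthogonalGroup_iff, Matrix.diagonal_transpose, Matrix.diagonal_mul_diagonal,
      ← Matrix.diagonal_one]
    congr 1
    ext i
    split_ifs <;> simp⟩

lemma colProj_signOrthogonal_mul (hrd : r ≤ d) (x : Fin d)
    (U : Matrix.orthogonalGroup (Fin d) ℝ) (i j : Fin d) :
    colProj hrd (signOrthogonal x * U) i j =
      (if i = x then -1 else 1) * (if j = x then -1 else 1) * colProj hrd U i j := by
  rw [colProj_mul, signOrthogonal, Matrix.diagonal_transpose, Matrix.mul_diagonal,
    Matrix.diagonal_mul]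
  ring

/-- An orthogonal map outside the signed permutations is needed to relate `T p p p p` to the other
moments. Reflecting along `e_p + 2 e_q` makes row `p` equal to `(3/5, -4/5)`, so all coefficients
are rational. -/
lemma exists_colProj_mul_apply (hrd : r ≤ d) {p q : Fin d} (hpq : p ≠ q) :
    ∃ V : Matrix.orthogonalGroup (Fin d) ℝ, ∀ U, colProj hrd (V * U) p p =
      9 / 25 * colProj hrd U p p + 16 / 25 * colProj hrd U q q - 24 / 25 * colProj hrd U p q := by
  set u : Fin d → ℝ := Pi.single p 1 + Pi.single q 2 with hu
  have huu : u ⬝ᵥ u = 5 := by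
    simp [hu, hpq, Ne.symm hpq]
    norm_num
  refine ⟨reflect u (by rw [huu]; norm_num), fun U => ?_⟩
  have hrow : (reflect u (by rw [huu]; norm_num) : Matrix (Fin d) (Fin d) ℝ) p =
      Pi.single p (3 / 5) + Pi.single q (-(4 / 5)) := by
    ext j
    have hup : u p = 1 := by simp [hu, hpq]
    simp only [reflect, huu, Matrix.sub_apply, Matrix.smul_apply, Matrix.vecMulVec_apply, hup]
    by_cases hjp : j = p
    · subst hjp
      simp [hu, hpq]
      norm_num
    · by_cases hjq : j = q
      · subst hjq
        simp [hu, hpq, hjp]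
        norm_num
      · simp [hu, hjp, hjq, Ne.symm hjp]
  have hquad : ∀ V M : Matrix (Fin d) (Fin d) ℝ, (V * M * Vᵀ) p p = (V p ᵥ* M) ⬝ᵥ V p :=
    fun V M => by
      simp [Matrix.mul_apply, dotProduct, Matrix.vecMul]
  rw [colProj_mul, hquad, hrow]
  simp [Matrix.add_vecMul, dotProduct_add]
  rw [colProj_apply_comm hrd U q p]
  ring

end

/-! ### Haar sketch. -/

section

variable {d r : ℕ}

section Invariant

variable {ν : Measure (Matrix.orthogonalGroup (Fin d) ℝ)} [IsProbabilityMeasure ν]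
  [ν.IsMulLeftInvariant]

lemma integral_colProj (hrd : r ≤ d) (i j : Fin d) :
    ∫ U, colProj hrd U i j ∂ν = r / d * (1 : Matrix (Fin d) (Fin d) ℝ) i j := by
  by_cases hij : i = j
  · subst hij
    have hd : (d : ℝ) ≠ 0 := by exact_mod_cast (Fin.pos i).ne'
    have h : ∀ j, ∫ U, colProj hrd U j j ∂ν = ∫ U, colProj hrd U i i ∂ν := fun j => by
      have := integral_mul_left_eq_self (μ := ν) (fun U => colProj hrd U j j)
        (permOrthogonal (Equiv.swap i j))
      simpa [colProj_permOrthogonal_mul] using this.symm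
    have htr : ∑ j, ∫ U, colProj hrd U j j ∂ν = r := by
      rw [← integral_finsetSum _ fun j _ => integrable_colProj hrd j j]
      have : ∀ U, ∑ j, colProj hrd U j j = r := trace_colProj hrd
      simp [this]
    simp only [h, Finset.sum_const, Finset.card_univ, Fintype.card_fin, nsmul_eq_mul] at htr
    simp only [Matrix.one_apply_eq]
    field_simp
    linarith
  · have := integral_mul_left_eq_self (μ := ν) (fun U => colProj hrd U i j) (signOrthogonal i)
    simp only [colProj_signOrthogonal_mul, integral_const_mul, Ne.symm hij, if_true,
      if_false] at this
    simp only [Matrix.one_apply_ne hij]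
    linarith

/-- Three linear relations fix the three free constants: `hrefl` (the diagonal term vanishes),
`hrow` (from `Π² = Π`) and `htr` (from `(tr Π)² = r²`). -/
lemma integral_colProj_mul (hd : 2 ≤ d) (hrd : r ≤ d) (i j k l : Fin d) :
    ∫ U, colProj hrd U i j * colProj hrd U k l ∂ν =
      momentTensor (r * (r * (d + 1) - 2) / (d * (d + 2) * (d - 1)))
        (r * (d - r) / (d * (d + 2) * (d - 1))) 0 i j k l := by
  set T : Fin d → Fin d → Fin d → Fin d → ℝ := fun i j k l =>
    ∫ U, colProj hrd U i j * colProj hrd U k l ∂ν with hT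
  have hinv : ∀ (V : Matrix.orthogonalGroup (Fin d) ℝ) i j k l,
      ∫ U, colProj hrd (V * U) i j * colProj hrd (V * U) k l ∂ν = T i j k l := fun V i j k l =>
    integral_mul_left_eq_self (μ := ν) (fun U => colProj hrd U i j * colProj hrd U k l) V
  have hsymm : ∀ i j k l, T i j l k = T i j k l := fun i j k l => by
    simp only [hT, colProj_apply_comm hrd _ l k]
  let p : Fin d := ⟨0, by omega⟩
  let q : Fin d := ⟨1, by omega⟩
  have hpq : p ≠ q := by simp [p, q]
  have key := eq_momentTensor_of_invariant hsymm
    (fun σ i j k l => by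
      rw [← hinv (permOrthogonal σ) i j k l]
      simp only [colProj_permOrthogonal_mul, hT])
    (fun x i j k l => by
      refine Eq.trans ?_ (hinv (signOrthogonal x) i j k l)
      rw [← integral_const_mul]
      congr 1
      ext U
      simp only [colProj_signOrthogonal_mul]
      ring) hpq
  have hrefl : T p p p p = T p p q q + 2 * T p q p q := by
    obtain ⟨V, hV⟩ := exists_colProj_mul_apply hrd hpq
    have h := hinv V p p p p
    have hexp : ∀ U, colProj hrd (V * U) p p * colProj hrd (V * U) p p =
        81 / 625 * (colProj hrd U p p * colProj hrd U p p) +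
        256 / 625 * (colProj hrd U q q * colProj hrd U q q) +
        576 / 625 * (colProj hrd U p q * colProj hrd U p q) +
        288 / 625 * (colProj hrd U p p * colProj hrd U q q) +
        -432 / 625 * (colProj hrd U p p * colProj hrd U p q) +
        -768 / 625 * (colProj hrd U q q * colProj hrd U p q) := fun U => by
      rw [hV]
      ring
    have hi : ∀ (c : ℝ) i j k l, Integrable
        (fun U => c * (colProj hrd U i j * colProj hrd U k l)) ν := fun c i j k l =>
      (integrable_colProj_mul hrd i j k l).const_mul c
    simp_rw [hexp] at h
    rw [integral_add, integral_add, integral_add, integral_add, integral_add] at h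
    rotate_left
    -- Five uses of `integral_add` leave ten integrability goals, brought in front of the main one
    -- by `rotate_left`.
    iterate 10
      · repeat' refine Integrable.fun_add ?_ ?_
        all_goals exact hi _ _ _ _ _
    simp only [integral_const_mul] at h
    -- By these symmetries the expanded square reads `(1 - 81/625 - 256/625) T_pppp = 288/625 T_ppqq
    -- + 576/625 T_pqpq`, and `1 - 81/625 - 256/625 = 288/625`.
    have h1 : T q q q q = T p p p p := by
      rw [key q q q q]
      simp only [momentTensor, Matrix.one_apply_eq]
      ring
    have h2 : T p p p q = 0 := by rw [key p p p q]; simp [momentTensor, hpq]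
    have h3 : T q q p q = 0 := by rw [key q q p q]; simp [momentTensor, hpq, Ne.symm hpq]
    simp only [hT] at h h1 h2 h3 ⊢
    rw [h1, h2, h3] at h
    linarith
  have hrow : ∑ k, T p k k p = r / d := by
    have h := integral_colProj (ν := ν) hrd p p
    have hU : ∀ U, colProj hrd U p p = ∑ k, colProj hrd U p k * colProj hrd U k p := fun U => by
      rw [← Matrix.mul_apply, colProj_mul_self]
    simp_rw [hU] at h
    rw [integral_finsetSum _ fun k _ => integrable_colProj_mul hrd p k k p] at h
    simpa using h
  have htr : ∑ i, ∑ j, T i i j j = (r : ℝ) ^ 2 := by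
    have hU : ∀ U, ∑ i, ∑ j, colProj hrd U i i * colProj hrd U j j = (r : ℝ) ^ 2 := fun U => by
      have h : ∑ i, colProj hrd U i i = r := trace_colProj hrd U
      rw [← Finset.sum_mul_sum, h, sq]
    simp only [hT]
    simp_rw [← integral_finsetSum Finset.univ fun j _ => integrable_colProj_mul hrd _ _ j j]
    rw [← integral_finsetSum _ fun i _ => integrable_finsetSum _ fun j _ =>
      integrable_colProj_mul hrd i i j j]
    simp [hU]
  rw [Finset.sum_congr rfl fun k _ => key p k k p, sum_momentTensor_row, hrefl] at hrow
  rw [Finset.sum_congr rfl fun i _ => Finset.sum_congr rfl fun j _ => key i i j j,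
    sum_momentTensor_diag_diag, hrefl] at htr
  have hd' : (2 : ℝ) ≤ d := by exact_mod_cast hd
  have hd0 : (d : ℝ) ≠ 0 := by positivity
  have hd1 : (d : ℝ) - 1 ≠ 0 := by linarith
  have hd2 : (d : ℝ) + 2 ≠ 0 := by positivity
  have hden : (d : ℝ) * (d + 2) * (d - 1) ≠ 0 := by positivity
  rw [eq_div_iff hd0] at hrow
  -- With `A = T p p q q` and `B = T p q p q`, the system is `d (A + (d + 1) B) = r`, `d² A + 2 d B
  -- = r²`. Eliminating `A` leaves `d (d + 2) (d - 1) B = r (d - r)`.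
  have hc : T p q p q = r * (d - r) / (d * (d + 2) * (d - 1)) := by
    rw [eq_div_iff hden]
    linear_combination d * hrow - htr
  have he : T p p q q = r * (r * (d + 1) - 2) / (d * (d + 2) * (d - 1)) := by
    rw [eq_div_iff hden]
    linear_combination (d + 1) * htr - 2 * hrow
  have := key i j k l
  rwa [hrefl, show T p p q q + 2 * T p q p q - T p p q q - 2 * T p q p q = 0 by ring,
    hc, he] at this

end Invariant

theorem sketchMoments_haar {Ω : Type*} [MeasurableSpace Ω] {μ : Measure Ω}
    [IsProbabilityMeasure μ] (hd : 2 ≤ d) (hr : 1 ≤ r) (hrd : r ≤ d)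
    {Lmat : Matrix (Fin d) (Fin d) ℝ} (hpsd : Lmat.PosSemidef) (hL : 0 < opNorm Lmat)
    {U : Ω → Matrix.orthogonalGroup (Fin d) ℝ} (hU : IsHaarDistributed U μ) :
    SketchMoments (fun w => haarSketch hrd (U w)) μ Lmat (omegaHaar d r) (ellHaar r Lmat) := by
  obtain ⟨hUm, hUh⟩ := hU
  have := Measure.isProbabilityMeasure_map hUm
  have hd' : (2 : ℝ) ≤ d := by exact_mod_cast hd
  have hr' : (1 : ℝ) ≤ r := by exact_mod_cast hr
  have hrd' : (r : ℝ) ≤ d := by exact_mod_cast hrd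
  have hd1 : (0 : ℝ) < d - 1 := by linarith
  have hden : 0 < ((d : ℝ) + 2) * (d - 1) := by positivity
  have hβ₀ : 0 ≤ beta d r := by
    have : (0 : ℝ) ≤ d - r := by linarith
    rw [beta]
    positivity
  have hβ₁ : beta d r ≤ 1 := by
    rw [beta, div_le_one hden]
    nlinarith
  have hAB : ((d : ℝ) / r) ^ 2 * (r * (r * (d + 1) - 2) / (d * (d + 2) * (d - 1))) +
      ((d : ℝ) / r) ^ 2 * (r * (d - r) / (d * (d + 2) * (d - 1))) =
      d / r * (1 - beta d r) := by
    rw [beta]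
    field_simp
    ring
  have hB : ((d : ℝ) / r) ^ 2 * (r * (d - r) / (d * (d + 2) * (d - 1))) =
      d / r * beta d r / d := by
    rw [beta]
    field_simp
  have htr : Lmat.trace = rEff Lmat * opNorm Lmat := by rw [rEff, div_mul_cancel₀ _ hL.ne']
  have happ : ∀ V i j, (haarSketch hrd V * (haarSketch hrd V).transpose) i j =
      d / r * colProj hrd V i j := fun V i j => by
    rw [haarSketch_mul_transpose]
    rfl
  have happ₂ : ∀ V i j k l, (haarSketch hrd V * (haarSketch hrd V).transpose) i j *
      (haarSketch hrd V * (haarSketch hrd V).transpose) k l =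
      ((d : ℝ) / r) ^ 2 * (colProj hrd V i j * colProj hrd V k l) := fun V i j k l => by
    rw [happ, happ]
    ring
  refine sketchMoments_of_momentTensor hpsd (C := ((d : ℝ) / r) ^ 2 * 0) ?_ ?_ ?_ ?_ ?_ ?_ ?_
    ?_ ?_ ?_ ?_ (A := ((d : ℝ) / r) ^ 2 * (r * (r * (d + 1) - 2) / (d * (d + 2) * (d - 1))))
    (B := ((d : ℝ) / r) ^ 2 * (r * (d - r) / (d * (d + 2) * (d - 1))))
  · rw [hAB]
    have : 0 ≤ 1 - beta d r := by linarith
    positivity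
  · simp
  · intro i j
    have : Measurable fun V : Matrix.orthogonalGroup (Fin d) ℝ => haarSketch hrd V i j :=
      ((continuous_orthogonal_apply i (Fin.castLE hrd j)).const_smul
        (Real.sqrt ((d : ℝ) / r))).measurable
    exact this.comp_aemeasurable hUm
  · intro i j
    simp only [happ]
    exact ((integrable_colProj (ν := μ.map U) hrd i j).comp_aemeasurable hUm).const_mul _
  · intro i j k l
    simp only [happ₂]
    exact ((integrable_colProj_mul (ν := μ.map U) hrd i j k l).comp_aemeasurable hUm).const_mul _
  · intro i j
    simp only [happ]
    rw [integral_const_mul, ← integral_map hUm (f := fun V => colProj hrd V i j)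
      (continuous_colProj hrd i j).measurable.aestronglyMeasurable, integral_colProj]
    field_simp
  · intro i j k l
    simp only [happ₂]
    rw [integral_const_mul, ← integral_map hUm
      (f := fun V => colProj hrd V i j * colProj hrd V k l)
      ((continuous_colProj hrd i j).mul (continuous_colProj hrd k l)).measurable.aestronglyMeasurable,
      integral_colProj_mul hd, momentTensor_smul]
  · rw [hAB, hB, omegaHaar]
    field_simp
    ring
  · rw [omegaHaar]
    positivity
  · rw [hAB, hB, ellHaar, htr]
    field_simp
    ring
  · have h1 := one_le_rEff hpsd hL
    have h2 : 0 ≤ 1 - beta d r := by linarith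
    rw [ellHaar]
    refine mul_pos (by positivity) ?_
    -- If `β = 0` the bracket is 1; otherwise `1 - β ≥ 0` and the effective rank term is positive.
    rcases hβ₀.eq_or_lt with h | h
    · simp [← h]
    · have : 0 < beta d r * (rEff Lmat / d) := by positivity
      linarith

end

/-! ### Coordinate sketch. -/

section

variable {d r : ℕ} {Ω : Type*} [MeasurableSpace Ω] {μ : Measure Ω}

/-- The diagonal `0`-`1` matrix with support `s`. -/
def coordProj (s : Finset (Fin d)) : Matrix (Fin d) (Fin d) ℝ :=
  Matrix.diagonal fun i => if i ∈ s then 1 else 0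

lemma coordinateSketch_mul_transpose (J : Fin r ↪ Fin d) :
    coordinateSketch J * (coordinateSketch J)ᵀ =
      ((d : ℝ) / r) • coordProj (Finset.univ.map J) := by
  rw [coordinateSketch, Matrix.transpose_smul, Matrix.smul_mul, Matrix.mul_smul, smul_smul,
    Real.mul_self_sqrt (by positivity)]
  congr 1
  ext i j
  simp only [coordProj, Matrix.mul_apply, Matrix.submatrix_apply, Matrix.transpose_apply, id,
    Matrix.one_apply, Matrix.diagonal_apply, Finset.mem_map, Finset.mem_univ, true_and]
  by_cases hij : i = j
  · subst hij
    by_cases h : ∃ a, J a = i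
    · obtain ⟨a, rfl⟩ := h
      simp
    · have h' : ∀ a, i ≠ J a := fun a ha => h ⟨a, ha.symm⟩
      simp [h, h']
  · rw [if_neg hij]
    refine Finset.sum_eq_zero fun a _ => ?_
    by_cases h : i = J a
    · have : j ≠ J a := fun hj => hij (h.trans hj.symm)
      simp [this]
    · simp [h]

/-- Only the coordinates of `J` are assumed measurable, so `f` is factored through the finite space
of all maps `Fin r → Fin d`, where every function is measurable. -/
lemma aemeasurable_comp_sample [Nonempty (Fin r ↪ Fin d)] {β : Type*} [MeasurableSpace β]
    {J : Ω → (Fin r ↪ Fin d)} (hJ : ∀ k, AEMeasurable (fun w => J w k) μ)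
    (f : (Fin r ↪ Fin d) → β) : AEMeasurable (fun w => f (J w)) μ := by
  have h : AEMeasurable (fun w k => J w k) μ := aemeasurable_pi_lambda _ hJ
  let F : (Fin r → Fin d) → β := fun g => f (Function.invFun (fun (e : Fin r ↪ Fin d) => ⇑e) g)
  have hF : ∀ w, f (J w) = F fun k => J w k := fun w => by
    simp only [F]
    rw [Function.leftInverse_invFun DFunLike.coe_injective]
  simp_rw [hF]
  exact (measurable_of_finite F).comp_aemeasurable h

lemma integrable_comp_sample [IsFiniteMeasure μ] [Nonempty (Fin r ↪ Fin d)]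
    {J : Ω → (Fin r ↪ Fin d)} (hJ : ∀ k, AEMeasurable (fun w => J w k) μ)
    (f : (Fin r ↪ Fin d) → ℝ) : Integrable (fun w => f (J w)) μ := by
  obtain ⟨C, hC⟩ := (Set.finite_range fun e => ‖f e‖).bddAbove
  exact Integrable.of_bound (aemeasurable_comp_sample hJ f).aestronglyMeasurable C
    (ae_of_all _ fun w => hC ⟨J w, rfl⟩)

/-- The weight of a set depends only on its cardinality, which is what yields permutation
invariance; the order in which `J` lists the set never enters. -/
lemma integral_comp_sample [IsFiniteMeasure μ] [Nonempty (Fin r ↪ Fin d)]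
    {J : Ω → (Fin r ↪ Fin d)} (hJ : IsUniformSample J μ) (f : Finset (Fin d) → ℝ) :
    ∫ w, f (Finset.univ.map (J w)) ∂μ =
      ∑ s, (if s.card = r then (((d.choose r : ℕ) : ENNReal)⁻¹).toReal else 0) * f s := by
  let _ : MeasurableSpace (Finset (Fin d)) := ⊤
  have hX : AEMeasurable (fun w => Finset.univ.map (J w)) μ :=
    aemeasurable_comp_sample hJ.1 fun e => Finset.univ.map e
  rw [← integral_map hX (f := f) (measurable_of_finite f).aestronglyMeasurable,
    integral_fintype (Integrable.of_finite)]
  refine Finset.sum_congr rfl fun s _ => ?_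
  rw [smul_eq_mul, measureReal_def, Measure.map_apply_of_aemeasurable hX (by trivial)]
  congr 1
  split_ifs with hs
  · rw [← hJ.2 s hs]
    rfl
  · have : (fun w => Finset.univ.map (J w)) ⁻¹' {s} = ∅ := by
      ext w
      simp only [Set.mem_preimage, Set.mem_singleton_iff, Set.mem_empty_iff_false, iff_false]
      rintro rfl
      simp at hs
    simp [this]

lemma integral_comp_sample_perm [IsFiniteMeasure μ] [Nonempty (Fin r ↪ Fin d)]
    {J : Ω → (Fin r ↪ Fin d)} (hJ : IsUniformSample J μ) (f : Finset (Fin d) → ℝ)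
    (σ : Equiv.Perm (Fin d)) :
    ∫ w, f ((Finset.univ.map (J w)).map σ.toEmbedding) ∂μ =
      ∫ w, f (Finset.univ.map (J w)) ∂μ := by
  rw [integral_comp_sample hJ fun s => f (s.map σ.toEmbedding), integral_comp_sample hJ]
  refine Fintype.sum_equiv σ.finsetCongr _ _ fun s => ?_
  simp [Equiv.finsetCongr_apply]

lemma coordProj_map (σ : Equiv.Perm (Fin d)) (s : Finset (Fin d)) (i j : Fin d) :
    coordProj (s.map σ.toEmbedding) (σ i) (σ j) = coordProj s i j := by
  simp [coordProj, Matrix.diagonal_apply]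

lemma trace_coordProj (J : Fin r ↪ Fin d) :
    (coordProj (Finset.univ.map J)).trace = r := by
  have : (Finset.univ.filter fun i => i ∈ Finset.univ.map J).card = r := by
    simp only [Finset.filter_univ_mem, Finset.card_map, Finset.card_univ, Fintype.card_fin]
  rw [coordProj, Matrix.trace_diagonal, Finset.sum_boole, this]

lemma integral_coordProj [IsProbabilityMeasure μ] [Nonempty (Fin r ↪ Fin d)]
    {J : Ω → (Fin r ↪ Fin d)} (hJ : IsUniformSample J μ) (i j : Fin d) :
    ∫ w, coordProj (Finset.univ.map (J w)) i j ∂μ =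
      r / d * (1 : Matrix (Fin d) (Fin d) ℝ) i j := by
  by_cases hij : i = j
  · subst hij
    have hd : (d : ℝ) ≠ 0 := by exact_mod_cast (Fin.pos i).ne'
    have h : ∀ j, ∫ w, coordProj (Finset.univ.map (J w)) j j ∂μ =
        ∫ w, coordProj (Finset.univ.map (J w)) i i ∂μ := fun j => by
      rw [← integral_comp_sample_perm hJ (fun s => coordProj s j j) (Equiv.swap i j)]
      congr 1
      ext w
      rw [← coordProj_map (Equiv.swap i j) _ i i, Equiv.swap_apply_left]
    have htr : ∑ j, ∫ w, coordProj (Finset.univ.map (J w)) j j ∂μ = r := by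
      rw [← integral_finsetSum _ fun j _ =>
        integrable_comp_sample hJ.1 fun e => coordProj (Finset.univ.map e) j j]
      have : ∀ w, ∑ j, coordProj (Finset.univ.map (J w)) j j = r := fun w =>
        trace_coordProj (J w)
      simp [this]
    simp only [h, Finset.sum_const, Finset.card_univ, Fintype.card_fin, nsmul_eq_mul] at htr
    simp only [Matrix.one_apply_eq]
    field_simp
    linarith
  · simp [coordProj, hij]

lemma integral_coordProj_mul [IsProbabilityMeasure μ] [Nonempty (Fin r ↪ Fin d)] (hd : 2 ≤ d)
    {J : Ω → (Fin r ↪ Fin d)} (hJ : IsUniformSample J μ) (i j k l : Fin d) :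
    ∫ w, coordProj (Finset.univ.map (J w)) i j * coordProj (Finset.univ.map (J w)) k l ∂μ =
      momentTensor (r * (r - 1) / (d * (d - 1))) 0 (r / d - r * (r - 1) / (d * (d - 1)))
        i j k l := by
  set T : Fin d → Fin d → Fin d → Fin d → ℝ := fun i j k l =>
    ∫ w, coordProj (Finset.univ.map (J w)) i j * coordProj (Finset.univ.map (J w)) k l ∂μ with hT
  have hint : ∀ i j k l, Integrable (fun w => coordProj (Finset.univ.map (J w)) i j *
      coordProj (Finset.univ.map (J w)) k l) μ := fun i j k l =>
    integrable_comp_sample hJ.1 fun e =>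
      coordProj (Finset.univ.map e) i j * coordProj (Finset.univ.map e) k l
  have hdiag : ∀ i j k l, (i ≠ j ∨ k ≠ l) → T i j k l = 0 := fun i j k l h => by
    rcases h with h | h <;> simp [hT, coordProj, h]
  let p : Fin d := ⟨0, by omega⟩
  let q : Fin d := ⟨1, by omega⟩
  have hpq : p ≠ q := by simp [p, q]
  have key := eq_momentTensor_of_invariant (T := T)
    (fun i j k l => by
      by_cases h : k = l
      · rw [h]
      · rw [hdiag _ _ _ _ (Or.inr h), hdiag _ _ _ _ (Or.inr (Ne.symm h))])
    (fun σ i j k l => by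
      simp only [hT]
      rw [← integral_comp_sample_perm hJ
        (fun s => coordProj s (σ i) (σ j) * coordProj s (σ k) (σ l)) σ]
      simp only [coordProj_map])
    -- No sign invariance of the law is needed: `T` is supported on `i = j`, `k = l`, where the
    -- signs cancel in pairs.
    (fun x i j k l => by
      by_cases h : i = j ∧ k = l
      · obtain ⟨rfl, rfl⟩ := h
        split_ifs <;> ring
      · rw [hdiag _ _ _ _ (by tauto), mul_zero]) hpq
  have hc : T p q p q = 0 := hdiag _ _ _ _ (Or.inl hpq)
  -- The diagonal entries are 0 or 1, hence equal to their squares.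
  have ha : T p p p p = r / d := by
    have h := integral_coordProj hJ p p
    simp only [Matrix.one_apply_eq, mul_one] at h
    rw [← h]
    simp only [hT]
    congr 1
    ext w
    simp [coordProj]
  have htr : ∑ i, ∑ j, T i i j j = (r : ℝ) ^ 2 := by
    have hU : ∀ w, ∑ i, ∑ j, coordProj (Finset.univ.map (J w)) i i *
        coordProj (Finset.univ.map (J w)) j j = (r : ℝ) ^ 2 := fun w => by
      have h : ∑ i, coordProj (Finset.univ.map (J w)) i i = r := trace_coordProj (J w)
      rw [← Finset.sum_mul_sum, h, sq]
    simp only [hT]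
    simp_rw [← integral_finsetSum Finset.univ fun j _ => hint _ _ j j]
    rw [← integral_finsetSum _ fun i _ => integrable_finsetSum _ fun j _ => hint i i j j]
    simp [hU]
  rw [Finset.sum_congr rfl fun i _ => Finset.sum_congr rfl fun j _ => key i i j j,
    sum_momentTensor_diag_diag, hc, ha] at htr
  have hd' : (2 : ℝ) ≤ d := by exact_mod_cast hd
  have hd0 : (d : ℝ) ≠ 0 := by positivity
  have hd1 : (d : ℝ) - 1 ≠ 0 := by linarith
  have he : T p p q q = r * (r - 1) / (d * (d - 1)) := by
    rw [eq_div_iff (mul_ne_zero hd0 hd1)]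
    have : (d : ℝ) * (r / d) = r := by field_simp
    linear_combination htr - this
  have := key i j k l
  rwa [hc, ha, he, mul_zero, sub_zero] at this

theorem sketchMoments_coordinate [IsProbabilityMeasure μ] (hd : 2 ≤ d) (hr : 1 ≤ r) (hrd : r ≤ d)
    {Lmat : Matrix (Fin d) (Fin d) ℝ} (hpsd : Lmat.PosSemidef) (hL : 0 < opNorm Lmat)
    {J : Ω → (Fin r ↪ Fin d)} (hJ : IsUniformSample J μ) :
    SketchMoments (fun w => coordinateSketch (J w)) μ Lmat (omegaCoordinate d r)
      (ellCoordinate r Lmat) := by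
  have : Nonempty (Fin r ↪ Fin d) := ⟨Fin.castLEEmb hrd⟩
  have hd' : (2 : ℝ) ≤ d := by exact_mod_cast hd
  have hr' : (1 : ℝ) ≤ r := by exact_mod_cast hr
  have hrd' : (r : ℝ) ≤ d := by exact_mod_cast hrd
  have hd1 : (0 : ℝ) < d - 1 := by linarith
  have hr1 : (0 : ℝ) ≤ r - 1 := by linarith
  have hdr : (0 : ℝ) ≤ d - r := by linarith
  have hA : ((d : ℝ) / r) ^ 2 * (r * (r - 1) / (d * (d - 1))) =
      d / r * ((r - 1) / (d - 1)) := by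
    field_simp
  have hC : ((d : ℝ) / r) ^ 2 * (r / d - r * (r - 1) / (d * (d - 1))) =
      d / r * ((d - r) / (d - 1)) := by
    field_simp
    ring
  have hδ : opNorm (diagPart Lmat) = deltaDiag Lmat * opNorm Lmat := by
    rw [deltaDiag, div_mul_cancel₀ _ hL.ne']
  have happ : ∀ e i j, (coordinateSketch e * (coordinateSketch e).transpose) i j =
      (d : ℝ) / r * coordProj (Finset.univ.map e) i j := fun e i j => by
    rw [coordinateSketch_mul_transpose]
    rfl
  have happ₂ : ∀ e i j k l, (coordinateSketch e * (coordinateSketch e).transpose) i j *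
      (coordinateSketch e * (coordinateSketch e).transpose) k l =
      ((d : ℝ) / r) ^ 2 * (coordProj (Finset.univ.map e) i j *
        coordProj (Finset.univ.map e) k l) := fun e i j k l => by
    rw [happ, happ]
    ring
  refine sketchMoments_of_momentTensor hpsd ?_ ?_ ?_ ?_ ?_ ?_ ?_
    ?_ ?_ ?_ ?_ (A := ((d : ℝ) / r) ^ 2 * (r * (r - 1) / (d * (d - 1))))
    (B := ((d : ℝ) / r) ^ 2 * 0)
    (C := ((d : ℝ) / r) ^ 2 * (r / d - r * (r - 1) / (d * (d - 1))))
  · rw [hA, mul_zero, add_zero]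
    positivity
  · rw [hC]
    positivity
  · exact fun i j => aemeasurable_comp_sample hJ.1 fun e => coordinateSketch e i j
  · exact fun i j => integrable_comp_sample hJ.1 fun e =>
      (coordinateSketch e * (coordinateSketch e).transpose) i j
  · exact fun i j k l => integrable_comp_sample hJ.1 fun e =>
      (coordinateSketch e * (coordinateSketch e).transpose) i j *
        (coordinateSketch e * (coordinateSketch e).transpose) k l
  · intro i j
    simp only [happ]
    rw [integral_const_mul, integral_coordProj hJ]
    field_simp
  · intro i j k l
    simp only [happ₂]
    rw [integral_const_mul, integral_coordProj_mul hd hJ, momentTensor_smul]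
  · rw [hA, hC, omegaCoordinate]
    field_simp
    ring
  · rw [omegaCoordinate]
    positivity
  · rw [hA, hC, ellCoordinate, hδ]
    ring
  · have h1 : 0 < deltaDiag Lmat :=
      lt_of_lt_of_le (by positivity) (one_div_le_deltaDiag (by omega) hpsd hL)
    rw [ellCoordinate]
    refine mul_pos (by positivity) ?_
    -- For `r = d` the `deltaDiag` term vanishes and `r - 1 = d - 1 > 0` is used; for `r < d` the
    -- `deltaDiag` term is positive.
    rcases hdr.eq_or_lt with h | h
    · have : (0 : ℝ) < r - 1 := by linarith
      have : 0 < ((r : ℝ) - 1) / (d - 1) := by positivity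
      simpa [← h] using this
    · positivity

end

/-! ### Gaussian moments and the Gaussian sketch. -/

section

lemma integral_pow_two_gaussianReal (v : NNReal) : ∫ x, x ^ 2 ∂(gaussianReal 0 v) = v := by
  have h := variance_fun_id_gaussianReal (μ := 0) (v := v)
  rwa [variance_of_integral_eq_zero aemeasurable_id' (by simp)] at h

/-- The fourth derivative at 0 of the moment generating function `exp (v t² / 2)`. Each derivative
is a polynomial times this exponential, so `hpoly` reduces the computation to coefficients. -/
lemma integral_pow_four_gaussianReal (v : NNReal) :
    ∫ x, x ^ 4 ∂(gaussianReal 0 v) = 3 * (v : ℝ) ^ 2 := by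
  have h := iteratedDeriv_mgf_zero (X := id) (μ := gaussianReal 0 v)
    (by simp [integrableExpSet_id_gaussianReal]) 4
  have hpoly : ∀ a b c e f : ℝ, deriv (fun t => (a + b * t + c * t ^ 2 + e * t ^ 3 + f * t ^ 4) *
      Real.exp (v * t ^ 2 / 2)) = fun t => (b + (2 * c + v * a) * t + (3 * e + v * b) * t ^ 2 +
      (4 * f + v * c) * t ^ 3 + v * e * t ^ 4 + v * f * t ^ 5) * Real.exp (v * t ^ 2 / 2) :=
    fun a b c e f => by
      ext t
      have h1 : HasDerivAt (fun t : ℝ => a + b * t + c * t ^ 2 + e * t ^ 3 + f * t ^ 4)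
          (b * 1 + c * (2 * t) + e * (3 * t ^ 2) + f * (4 * t ^ 3)) t := by
        have := (((((hasDerivAt_id t).const_mul b).const_add a).fun_add
          ((hasDerivAt_pow 2 t).const_mul c)).fun_add ((hasDerivAt_pow 3 t).const_mul e)).fun_add
          ((hasDerivAt_pow 4 t).const_mul f)
        simpa using this
      have h2 : HasDerivAt (fun t : ℝ => Real.exp (v * t ^ 2 / 2))
          (Real.exp (v * t ^ 2 / 2) * (v * (2 * t) / 2)) t := by
        have := (((hasDerivAt_pow 2 t).const_mul (v : ℝ)).div_const 2).exp
        simpa using this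
      rw [(h1.fun_mul h2).deriv]
      ring
  have h0 : mgf id (gaussianReal 0 v) = fun t =>
      (1 + 0 * t + 0 * t ^ 2 + 0 * t ^ 3 + 0 * t ^ 4) * Real.exp (v * t ^ 2 / 2) := by
    rw [mgf_id_gaussianReal]
    ext t
    simp
  have h1 : deriv (mgf id (gaussianReal 0 v)) = fun t =>
      (0 + v * t + 0 * t ^ 2 + 0 * t ^ 3 + 0 * t ^ 4) * Real.exp (v * t ^ 2 / 2) := by
    rw [h0, hpoly]
    ext t
    ring
  have h2 : deriv (deriv (mgf id (gaussianReal 0 v))) = fun t =>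
      (v + 0 * t + v ^ 2 * t ^ 2 + 0 * t ^ 3 + 0 * t ^ 4) * Real.exp (v * t ^ 2 / 2) := by
    rw [h1, hpoly]
    ext t
    ring
  have h3 : deriv (deriv (deriv (mgf id (gaussianReal 0 v)))) = fun t =>
      (0 + 3 * v ^ 2 * t + 0 * t ^ 2 + v ^ 3 * t ^ 3 + 0 * t ^ 4) *
        Real.exp (v * t ^ 2 / 2) := by
    rw [h2, hpoly]
    ext t
    ring
  simp only [iteratedDeriv_succ, iteratedDeriv_zero] at h
  rw [h3, hpoly] at h
  simpa using h.symm

section Family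

variable {Ω ι : Type*} [MeasurableSpace Ω] {μ : Measure Ω} {X : ι → Ω → ℝ} {v : NNReal}

lemma integrable_mul_of_gaussian (hX : ∀ p, HasLaw (X p) (gaussianReal 0 v) μ) (p q : ι) :
    Integrable (fun w => X p w * X q w) μ := by
  have h : ∀ p, MemLp (X p) 2 μ := fun p => by
    have := memLp_id_gaussianReal' (μ := 0) (v := v) 2 (by simp)
    rw [← (hX p).map_eq] at this
    exact this.comp_of_map (hX p).aemeasurable
  exact (h p).integrable_mul (h q)

/-- Domination by AM–GM: `|x y z t| ≤ x⁴ + y⁴ + z⁴ + t⁴`. -/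
lemma integrable_mul_mul_of_gaussian (hX : ∀ p, HasLaw (X p) (gaussianReal 0 v) μ)
    (p q s t : ι) : Integrable (fun w => X p w * X q w * (X s w * X t w)) μ := by
  have h : ∀ p, Integrable (fun w => X p w ^ 4) μ := fun p => by
    have := (memLp_id_gaussianReal' (μ := 0) (v := v) 4 (by simp))
    rw [← (hX p).map_eq] at this
    have := (this.comp_of_map (hX p).aemeasurable).integrable_norm_pow (by simp)
    simpa [Even.pow_abs (by decide : Even 4)] using this
  have hm := fun p => (hX p).aemeasurable
  refine Integrable.mono' (((h p).add (h q)).add ((h s).add (h t)))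
    (((hm p).mul (hm q)).mul ((hm s).mul (hm t))).aestronglyMeasurable (ae_of_all _ fun w => ?_)
  simp only [Pi.add_apply, Real.norm_eq_abs]
  rw [abs_le]
  constructor <;> nlinarith [sq_nonneg (X p w * X q w + X s w * X t w),
    sq_nonneg (X p w * X q w - X s w * X t w), sq_nonneg (X p w ^ 2 - X q w ^ 2),
    sq_nonneg (X s w ^ 2 - X t w ^ 2), sq_nonneg (X p w ^ 2), sq_nonneg (X q w ^ 2),
    sq_nonneg (X s w ^ 2), sq_nonneg (X t w ^ 2)]

lemma integral_eq_zero_of_gaussian (hX : ∀ p, HasLaw (X p) (gaussianReal 0 v) μ) (p : ι) :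
    ∫ w, X p w ∂μ = 0 := by
  rw [(hX p).integral_eq]
  simp

lemma integral_sq_of_gaussian (hX : ∀ p, HasLaw (X p) (gaussianReal 0 v) μ) (p : ι) :
    ∫ w, X p w ^ 2 ∂μ = v := by
  rw [← integral_pow_two_gaussianReal v]
  exact (hX p).integral_comp (f := fun x => x ^ 2) (by fun_prop)

lemma integral_mul_of_gaussian [DecidableEq ι] (hX : ∀ p, HasLaw (X p) (gaussianReal 0 v) μ)
    (hind : iIndepFun X μ) (p q : ι) :
    ∫ w, X p w * X q w ∂μ = v * (1 : Matrix ι ι ℝ) p q := by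
  have hm := fun p => (hX p).aemeasurable
  by_cases h : p = q
  · subst h
    simpa [← sq] using integral_sq_of_gaussian hX p
  · rw [(hind.indepFun h).integral_fun_mul_eq_mul_integral (hm p).aestronglyMeasurable
      (hm q).aestronglyMeasurable, integral_eq_zero_of_gaussian hX]
    simp [h]

lemma integral_mul_mul_eq_zero_of_ne (hX : ∀ p, HasLaw (X p) (gaussianReal 0 v) μ)
    (hind : iIndepFun X μ) {p q s t : ι} (hq : p ≠ q) (hs : p ≠ s) (ht : p ≠ t) :
    ∫ w, X p w * (X q w * X s w * X t w) ∂μ = 0 := by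
  classical
  have hm := fun p => (hX p).aemeasurable
  have h := hind.indepFun_finset₀ {p} {q, s, t} (by simp [hq, hs, ht]) hm
  have h' : IndepFun (X p) (fun w => X q w * X s w * X t w) μ :=
    h.comp (φ := fun g : ({p} : Finset ι) → ℝ => g ⟨p, by simp⟩)
      (ψ := fun g : ({q, s, t} : Finset ι) → ℝ =>
        g ⟨q, by simp⟩ * g ⟨s, by simp⟩ * g ⟨t, by simp⟩)
      (by fun_prop) (by fun_prop)
  rw [h'.integral_fun_mul_eq_mul_integral (hm p).aestronglyMeasurable
      (((hm q).mul (hm s)).mul (hm t)).aestronglyMeasurable, integral_eq_zero_of_gaussian hX,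
      zero_mul]

lemma integral_sq_mul_sq_of_ne (hX : ∀ p, HasLaw (X p) (gaussianReal 0 v) μ)
    (hind : iIndepFun X μ) {p q : ι} (hpq : p ≠ q) :
    ∫ w, X p w ^ 2 * X q w ^ 2 ∂μ = (v : ℝ) ^ 2 := by
  have hm := fun p => (hX p).aemeasurable
  have h : IndepFun (fun w => X p w ^ 2) (fun w => X q w ^ 2) μ :=
    (hind.indepFun hpq).comp (φ := fun x => x ^ 2) (ψ := fun x => x ^ 2) (by fun_prop)
      (by fun_prop)
  rw [h.integral_fun_mul_eq_mul_integral ((hm p).pow_const 2).aestronglyMeasurable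
    ((hm q).pow_const 2).aestronglyMeasurable, integral_sq_of_gaussian hX,
    integral_sq_of_gaussian hX, sq]

/-- The fourth order moments of independent centred Gaussian variables. -/
lemma integral_mul_mul_of_gaussian [DecidableEq ι]
    (hX : ∀ p, HasLaw (X p) (gaussianReal 0 v) μ) (hind : iIndepFun X μ) (p q s t : ι) :
    ∫ w, X p w * X q w * (X s w * X t w) ∂μ = (v : ℝ) ^ 2 *
      ((1 : Matrix ι ι ℝ) p q * (1 : Matrix ι ι ℝ) s t +
        ((1 : Matrix ι ι ℝ) p s * (1 : Matrix ι ι ℝ) q t +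
          (1 : Matrix ι ι ℝ) p t * (1 : Matrix ι ι ℝ) q s)) := by
  -- Either some index differs from the other three and its zero mean kills the product (`single`),
  -- or the indices form two distinct pairs (`pair`), or all coincide. Taking `f` up to pointwise
  -- equality lets `ring` reorder the factors.
  have single : ∀ {p q s t : ι}, p ≠ q → p ≠ s → p ≠ t → ∀ {f : Ω → ℝ},
      (∀ w, f w = X p w * (X q w * X s w * X t w)) → ∫ w, f w ∂μ = 0 :=
    fun hq hs ht f hf => by
      simp_rw [hf]
      exact integral_mul_mul_eq_zero_of_ne hX hind hq hs ht
  have pair : ∀ {p q : ι}, p ≠ q → ∀ {f : Ω → ℝ},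
      (∀ w, f w = X p w ^ 2 * X q w ^ 2) → ∫ w, f w ∂μ = (v : ℝ) ^ 2 := fun h f hf => by
    simp_rw [hf]
    exact integral_sq_mul_sq_of_ne hX hind h
  simp only [Matrix.one_apply]
  by_cases hpq : p = q
  · subst hpq
    by_cases hst : s = t
    · subst hst
      by_cases hps : p = s
      · subst hps
        have h4 : ∫ w, X p w ^ 4 ∂μ = 3 * (v : ℝ) ^ 2 := by
          rw [← integral_pow_four_gaussianReal v]
          exact (hX p).integral_comp (f := fun x => x ^ 4) (by fun_prop)
        have he : ∀ w, X p w * X p w * (X p w * X p w) = X p w ^ 4 := fun w => by ring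
        simp_rw [he, h4]
        simp
        ring
      · rw [pair hps fun w => by ring]
        simp [hps]
    · by_cases hps : p = s
      · subst hps
        rw [single (Ne.symm hst) (Ne.symm hst) (Ne.symm hst) fun w => by ring]
        simp [hst]
      · rw [single (Ne.symm hps) (Ne.symm hps) hst fun w => by ring]
        simp [hst, hps]
  · by_cases hps : p = s
    · subst hps
      by_cases hqt : q = t
      · subst hqt
        rw [pair hpq fun w => by ring]
        simp [hpq]
      · rw [single (Ne.symm hpq) (Ne.symm hpq) hqt fun w => by ring]
        simp [hpq, hqt, Ne.symm hpq]
    · by_cases hpt : p = t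
      · subst hpt
        by_cases hqs : q = s
        · subst hqs
          rw [pair hpq fun w => by ring]
          simp [hpq]
        · rw [single (Ne.symm hpq) (Ne.symm hpq) hqs fun w => by ring]
          simp [hpq, hqs, hps]
      · rw [single hpq hps hpt fun w => by ring]
        simp [hpq, hps, hpt]

end Family

theorem sketchMoments_gaussian {Ω : Type*} [MeasurableSpace Ω] {μ : Measure Ω} {d r : ℕ}
    (hr : 1 ≤ r) {Lmat : Matrix (Fin d) (Fin d) ℝ} (hpsd : Lmat.PosSemidef)
    (hL : 0 < opNorm Lmat) {P : Ω → Matrix (Fin d) (Fin r) ℝ} (hP : IsGaussianSketch P μ) :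
    SketchMoments P μ Lmat (omegaGaussian d r) (ellGaussian r Lmat) := by
  obtain ⟨hlaw, hind⟩ := hP
  have hr' : (0 : ℝ) < r := by exact_mod_cast hr
  have hX : ∀ p : Fin d × Fin r,
      HasLaw (fun w => P w p.1 p.2) (gaussianReal 0 (1 / (r : NNReal))) μ :=
    fun p => hlaw p.1 p.2
  have h1 := one_le_rEff hpsd hL
  have htr : Lmat.trace = rEff Lmat * opNorm Lmat := by rw [rEff, div_mul_cancel₀ _ hL.ne']
  have hone : ∀ (i j : Fin d) (a b : Fin r), (1 : Matrix (Fin d × Fin r) (Fin d × Fin r) ℝ)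
      (i, a) (j, b) = (1 : Matrix (Fin d) (Fin d) ℝ) i j * (1 : Matrix (Fin r) (Fin r) ℝ) a b :=
    fun i j a b => by
      by_cases hij : i = j <;> simp [Matrix.one_apply, hij]
  have happ : ∀ w i j, (P w * (P w).transpose) i j = ∑ a, P w i a * P w j a := fun w i j => rfl
  have happ₂ : ∀ w i j k l, (P w * (P w).transpose) i j * (P w * (P w).transpose) k l =
      ∑ a, ∑ b, P w i a * P w j a * (P w k b * P w l b) := fun w i j k l => by
    rw [happ, happ, Finset.sum_mul_sum]
  have hi₁ : ∀ i j a, Integrable (fun w => P w i a * P w j a) μ := fun i j a =>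
    integrable_mul_of_gaussian hX (i, a) (j, a)
  have hi₂ : ∀ i j k l a b, Integrable (fun w => P w i a * P w j a * (P w k b * P w l b)) μ :=
    fun i j k l a b => integrable_mul_mul_of_gaussian hX (i, a) (j, a) (k, b) (l, b)
  have hm₁ : ∀ i j a, ∫ w, P w i a * P w j a ∂μ =
      1 / r * (1 : Matrix (Fin d) (Fin d) ℝ) i j := fun i j a => by
    have := integral_mul_of_gaussian hX hind (i, a) (j, a)
    simpa [hone] using this
  have hm₂ : ∀ i j k l a b, ∫ w, P w i a * P w j a * (P w k b * P w l b) ∂μ =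
      (1 / r) ^ 2 * ((1 : Matrix (Fin d) (Fin d) ℝ) i j * (1 : Matrix (Fin d) (Fin d) ℝ) k l +
        (1 : Matrix (Fin r) (Fin r) ℝ) a b *
          ((1 : Matrix (Fin d) (Fin d) ℝ) i k * (1 : Matrix (Fin d) (Fin d) ℝ) j l +
            (1 : Matrix (Fin d) (Fin d) ℝ) i l * (1 : Matrix (Fin d) (Fin d) ℝ) j k)) :=
    fun i j k l a b => by
      have := integral_mul_mul_of_gaussian hX hind (i, a) (j, a) (k, b) (l, b)
      simp only [hone, Matrix.one_apply_eq, mul_one] at this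
      rw [this]
      -- Both cross pairings carry `δ_ab²`, which is `δ_ab`.
      have hsq : (1 : Matrix (Fin r) (Fin r) ℝ) a b * (1 : Matrix (Fin r) (Fin r) ℝ) a b =
          (1 : Matrix (Fin r) (Fin r) ℝ) a b := by
        simp [Matrix.one_apply]
      push_cast
      linear_combination (1 / (r : ℝ)) ^ 2 *
        ((1 : Matrix (Fin d) (Fin d) ℝ) i k * (1 : Matrix (Fin d) (Fin d) ℝ) j l +
            (1 : Matrix (Fin d) (Fin d) ℝ) i l * (1 : Matrix (Fin d) (Fin d) ℝ) j k) * hsq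
  refine sketchMoments_of_momentTensor hpsd (A := 1) (B := 1 / r) (C := 0) (by positivity) le_rfl
    (fun i j => (hlaw i j).aemeasurable) ?_ ?_ ?_ ?_ ?_ ?_ ?_ ?_
  · intro i j
    simp only [happ]
    exact integrable_finsetSum _ fun a _ => hi₁ i j a
  · intro i j k l
    simp only [happ₂]
    exact integrable_finsetSum _ fun a _ => integrable_finsetSum _ fun b _ => hi₂ i j k l a b
  · intro i j
    simp only [happ]
    rw [integral_finsetSum _ fun a _ => hi₁ i j a]
    simp only [hm₁, Finset.sum_const, Finset.card_univ, Fintype.card_fin, nsmul_eq_mul]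
    field_simp
  · intro i j k l
    simp only [happ₂]
    rw [integral_finsetSum _ fun a _ => integrable_finsetSum _ fun b _ => hi₂ i j k l a b]
    simp_rw [integral_finsetSum Finset.univ fun b _ => hi₂ i j k l _ b, hm₂, ← Finset.mul_sum,
      Finset.sum_add_distrib, ← Finset.sum_mul]
    -- The first pairing collects all `r²` pairs `(a, b)` and the cross pairings only the `r`
    -- diagonal ones; after the factor `1 / r²` this gives `A = 1` and `B = 1 / r`.
    have : ∑ a : Fin r, ∑ b, (1 : Matrix (Fin r) (Fin r) ℝ) a b = r := by
      simp [Matrix.one_apply]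
    rw [this]
    simp only [momentTensor, Finset.sum_const, Finset.card_univ, Fintype.card_fin, nsmul_eq_mul]
    field_simp
    ring
  · rw [omegaGaussian]
    field_simp
    ring
  · rw [omegaGaussian]
    positivity
  · rw [ellGaussian, htr]
    field_simp
    ring
  · rw [ellGaussian]
    positivity

end

end Sketch

theorem mainTheorem3 {Ω : Type*} [MeasurableSpace Ω] (μ : Measure Ω) [IsProbabilityMeasure μ]
    (d r : ℕ) (hd : 2 ≤ d) (hr : 1 ≤ r) (hrd : r ≤ d)
    (Lmat : Matrix (Fin d) (Fin d) ℝ) (hpsd : Lmat.PosSemidef)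
    (hL : 0 < Sketch.opNorm Lmat) :
    (∀ U : Ω → Matrix.orthogonalGroup (Fin d) ℝ, Sketch.IsHaarDistributed U μ →
      Sketch.SketchMoments (fun w => Sketch.haarSketch hrd (U w)) μ Lmat
        (Sketch.omegaHaar d r) (Sketch.ellHaar r Lmat)) ∧
    (∀ J : Ω → (Fin r ↪ Fin d), Sketch.IsUniformSample J μ →
      Sketch.SketchMoments (fun w => Sketch.coordinateSketch (J w)) μ Lmat
        (Sketch.omegaCoordinate d r) (Sketch.ellCoordinate r Lmat)) ∧
    (∀ P : Ω → Matrix (Fin d) (Fin r) ℝ, Sketch.IsGaussianSketch P μ →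
      Sketch.SketchMoments P μ Lmat
        (Sketch.omegaGaussian d r) (Sketch.ellGaussian r Lmat)) ∧
    (1 ≤ Sketch.rEff Lmat ∧ Sketch.rEff Lmat ≤ d) ∧
    (1 / (d : ℝ) ≤ Sketch.deltaDiag Lmat ∧ Sketch.deltaDiag Lmat ≤ 1) ∧
    Sketch.rEff Lmat / d ≤ Sketch.deltaDiag Lmat := by
  have hd₀ : 0 < d := by omega
  exact ⟨fun U hU => Sketch.sketchMoments_haar hd hr hrd hpsd hL hU,
    fun J hJ => Sketch.sketchMoments_coordinate hd hr hrd hpsd hL hJ,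
    fun P hP => Sketch.sketchMoments_gaussian hr hpsd hL hP,
    ⟨Sketch.one_le_rEff hpsd hL, Sketch.rEff_le hd₀ hpsd⟩,
    ⟨Sketch.one_div_le_deltaDiag hd₀ hpsd hL, Sketch.deltaDiag_le_one hpsd⟩,
    Sketch.rEff_div_le_deltaDiag hd₀ Lmat⟩
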